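/- **Theorem (Harmonic factorization).** Let $q=x^2+y^2+z^2$, and let $\mathcal H^n(\mathbb R^3)$ be the space of real homogeneous polynomials of degree $n$ on $\mathbb R^3$ with vanishing Laplacian. Every polynomial $p$ can be written in a unique way as $p=p_0+q\,r$ with $p_0$ harmonic; if $p$ is homogeneous, $p_0$ is the leading term $h_0$ of its harmonic decomposition $p=h_0+q\,h_1+q^2h_2+\cdots$ ($h_j$ harmonic). The harmonic product is $h_1 * h_2:=(h_1h_2)_0$; it is associative and commutative, with unit $1$. Let $\mathbb H^n(\mathbb R^3)$ be the space of harmonic tensors of order $n$, that is, totally symmetric $n$-linear forms on $\mathbb R^3$ with vanishing trace. For $H_1\in\mathbb H^{m}(\mathbb R^3)$ and $H_2\in\mathbb H^{n}(\mathbb R^3)$ the harmonic product is $H_1 * H_2:=(H_1\odot H_2)_0$, where $\odot$ is the symmetrized tensor product and $(\cdot)_0$ is the orthogonal projection onto $\mathbb H^{m+n}(\mathbb R^3)$. It corresponds to the harmonic product of polynomials under $T\mapsto T(\mathbf x,\dots,\mathbf x)$. Then: 1. For all integers $n\ge 0$, $k\ge 1$ and every $h\in\mathcal H^{kn}(\mathbb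 R^3)$ there exist $h_1,\dots,h_k\in\mathcal H^{n}(\mathbb R^3)$ such that $h=h_1*\cdots*h_k$. 2. Equivalently, in terms of tensors: for all integers $n\ge 0$, $k\ge 1$ and every $H\in\mathbb H^{kn}(\mathbb R^3)$ there exist $H_1,\dots,H_k\in\mathbb H^{n}(\mathbb R^3)$ such that $H=H_1*\cdots*H_k$. 3. In particular, every fourth-order harmonic tensor $H\in\mathbb H^4(\mathbb R^3)$ is of the form $H=h_1*h_2$ with $h_1,h_2\in\mathbb H^2(\mathbb R^3)$ second-order symmetric deviatoric (trace-free) tensors. -/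

import Mathlib

noncomputable section

namespace HarmonicFactorization

open MvPolynomial

/-! ## Harmonic polynomials on `ℝ³` and their product -/

/-- Polynomials in the coordinates `x, y, z` of `ℝ³`. -/
abbrev Poly3 : Type := MvPolynomial (Fin 3) ℝ

/-- The Laplacian `∂²/∂x² + ∂²/∂y² + ∂²/∂z²`. -/
def laplacian : Poly3 →ₗ[ℝ] Poly3 :=
  ∑ i : Fin 3, (pderiv i).toLinearMap ∘ₗ (pderiv i).toLinearMap

theorem laplacian_apply (p : Poly3) :
    laplacian p = ∑ i : Fin 3, pderiv i (pderiv i p) := by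
  simp [laplacian, LinearMap.sum_apply]

/-- The quadratic form `q = x² + y² + z²`. -/
def normSq : Poly3 := ∑ i : Fin 3, X i ^ 2

/-- The space of homogeneous harmonic polynomials of degree `n` on `ℝ³`. -/
def HarmPoly (n : ℕ) : Submodule ℝ Poly3 :=
  homogeneousSubmodule (Fin 3) ℝ n ⊓ LinearMap.ker laplacian

/-- Multiplication by `q`; its range is the set of multiples of `q`. -/
def mulNormSq : Poly3 →ₗ[ℝ] Poly3 := LinearMap.mulLeft ℝ normSq

theorem mulNormSq_apply (p : Poly3) : mulNormSq p = normSq * p := rfl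

/-- The factorial `∏ i, (m i)!` of a multi-index. -/
def multiFactorial (m : Fin 3 →₀ ℕ) : ℝ := ∏ i : Fin 3, ((m i).factorial : ℝ)

theorem multiFactorial_pos (m : Fin 3 →₀ ℕ) : 0 < multiFactorial m :=
  Finset.prod_pos fun i _ => by exact_mod_cast (m i).factorial_pos

theorem multiFactorial_add_single (m : Fin 3 →₀ ℕ) (i : Fin 3) :
    multiFactorial (m + Finsupp.single i 1) = (m i + 1) * multiFactorial m := by
  fin_cases i <;>
    simp [multiFactorial, Fin.prod_univ_three, Nat.factorial_succ] <;> ring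

/-- The apolar (Fischer) pairing `⟨p, r⟩ = ∑ m, m! pₘ rₘ`. -/
def fischer (r : Poly3) : Poly3 →ₗ[ℝ] ℝ :=
  (basisMonomials (Fin 3) ℝ).constr ℝ fun m => multiFactorial m * coeff m r

theorem fischer_monomial (r : Poly3) (m : Fin 3 →₀ ℕ) :
    fischer r (monomial m 1) = multiFactorial m * coeff m r := by
  have := (basisMonomials (Fin 3) ℝ).constr_basis ℝ
    (fun m => multiFactorial m * coeff m r) m
  simpa [fischer, coe_basisMonomials] using this

theorem fischer_X_mul (r p : Poly3) (i : Fin 3) :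
    fischer r (X i * p) = fischer (pderiv i r) p := by
  have h : fischer r ∘ₗ LinearMap.mulLeft ℝ (X i) = fischer (pderiv i r) := by
    refine (basisMonomials (Fin 3) ℝ).ext fun m => ?_
    have hm : (X i : Poly3) * monomial m 1 = monomial (m + Finsupp.single i 1) 1 := by
      rw [X, monomial_mul, one_mul, add_comm]
    simp only [coe_basisMonomials, LinearMap.comp_apply, LinearMap.mulLeft_apply]
    rw [hm, fischer_monomial, fischer_monomial, multiFactorial_add_single, coeff_pderiv]
    ring
  exact LinearMap.congr_fun h p

theorem fischer_self (p : Poly3) :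
    fischer p p = ∑ m ∈ p.support, multiFactorial m * coeff m p ^ 2 := by
  have hs : fischer p p = fischer p (∑ m ∈ p.support, monomial m (coeff m p)) := by
    rw [← p.as_sum]
  rw [hs, map_sum]
  refine Finset.sum_congr rfl fun m _ => ?_
  have : monomial m (coeff m p) = coeff m p • (monomial m 1 : Poly3) := by
    rw [smul_monomial, smul_eq_mul, mul_one]
  rw [this, map_smul, fischer_monomial, smul_eq_mul]
  ring

theorem eq_zero_of_fischer_self {p : Poly3} (h : fischer p p = 0) : p = 0 := by
  rw [fischer_self, Finset.sum_eq_zero_iff_of_nonneg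
    (fun m _ => mul_nonneg (multiFactorial_pos m).le (sq_nonneg _))] at h
  ext m
  by_contra hm
  have h1 := h m (mem_support_iff.2 hm)
  rcases mul_eq_zero.1 h1 with h2 | h2
  · exact (multiFactorial_pos m).ne' h2
  · exact hm (by simpa using h2)

theorem fischer_normSq_mul (r p : Poly3) :
    fischer r (normSq * p) = fischer (laplacian r) p := by
  have hadd : ∀ a b : Poly3, fischer (a + b) = fischer a + fischer b := by
    intro a b
    refine (basisMonomials (Fin 3) ℝ).ext fun m => ?_
    simp only [coe_basisMonomials, LinearMap.add_apply, fischer_monomial, coeff_add]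
    ring
  rw [laplacian_apply]
  simp only [normSq, Fin.sum_univ_three, hadd, LinearMap.add_apply, add_mul, map_add, sq,
    mul_assoc, fischer_X_mul]

theorem disjoint_ker_laplacian :
    Disjoint (LinearMap.ker laplacian) (LinearMap.range mulNormSq) := by
  rw [Submodule.disjoint_def]
  rintro _ h ⟨r, rfl⟩
  apply eq_zero_of_fischer_self
  conv_lhs => rw [mulNormSq_apply r]
  rw [fischer_normSq_mul, ← mulNormSq_apply, LinearMap.mem_ker.1 h]
  have : fischer 0 = 0 := (basisMonomials (Fin 3) ℝ).ext fun m => by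
    simp only [coe_basisMonomials, fischer_monomial]
    simp
  rw [this, LinearMap.zero_apply]

theorem normSq_ne_zero : normSq ≠ 0 := by
  intro h
  have := congrArg (eval fun _ => (1 : ℝ)) h
  simp [normSq] at this

theorem laplacian_normSq_mul_mem (n : ℕ) {p : Poly3}
    (hp : p ∈ homogeneousSubmodule (Fin 3) ℝ n) :
    laplacian (mulNormSq p) ∈ homogeneousSubmodule (Fin 3) ℝ n := by
  rw [mem_homogeneousSubmodule] at *
  have hq : normSq.IsHomogeneous 2 :=
    IsHomogeneous.sum _ _ _ fun i _ => isHomogeneous_X_pow i 2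
  rw [laplacian_apply, mulNormSq_apply]
  refine IsHomogeneous.sum _ _ _ fun i _ => ?_
  have h := ((hq.mul hp).pderiv (i := i)).pderiv (i := i)
  have e : 2 + n - 1 - 1 = n := by omega
  rwa [e] at h

theorem surjective_laplacian_mulNormSq :
    Function.Surjective (laplacian ∘ₗ mulNormSq) := by
  have hinj : Function.Injective (laplacian ∘ₗ mulNormSq) := by
    rw [injective_iff_map_eq_zero]
    intro p hp
    have h0 := Submodule.disjoint_def.1 disjoint_ker_laplacian (mulNormSq p)
      (LinearMap.mem_ker.2 hp) ⟨p, rfl⟩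
    exact (mul_eq_zero.1 h0).resolve_left normSq_ne_zero
  have hsurj : ∀ (n : ℕ), ∀ p ∈ homogeneousSubmodule (Fin 3) ℝ n,
      p ∈ LinearMap.range (laplacian ∘ₗ mulNormSq) := by
    intro n p hp
    have : Module.Finite ℝ (homogeneousSubmodule (Fin 3) ℝ n) :=
      Module.Finite.iff_fg.2 (homogeneousSubmodule_fg _ _ n)
    let L : homogeneousSubmodule (Fin 3) ℝ n →ₗ[ℝ] homogeneousSubmodule (Fin 3) ℝ n :=
      (laplacian ∘ₗ mulNormSq).restrict fun x hx => laplacian_normSq_mul_mem n hx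
    have hL : Function.Injective L := fun a b hab =>
      Subtype.ext (hinj (congrArg Subtype.val hab))
    obtain ⟨r, hr⟩ := LinearMap.injective_iff_surjective.1 hL ⟨p, hp⟩
    exact ⟨r, congrArg Subtype.val hr⟩
  intro p
  rw [← LinearMap.mem_range, ← sum_homogeneousComponent p]
  exact Submodule.sum_mem _ fun n _ => hsurj n _ (homogeneousComponent_mem n p)

/-- Every polynomial is, in a unique way, a harmonic polynomial plus a multiple of `q`. -/
theorem isCompl_harmonic :
    IsCompl (LinearMap.ker laplacian) (LinearMap.range mulNormSq) := by
  refine ⟨disjoint_ker_laplacian, codisjoint_iff.2 (eq_top_iff.2 fun p _ => ?_)⟩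
  obtain ⟨r, hr⟩ := surjective_laplacian_mulNormSq (laplacian p)
  refine Submodule.mem_sup.2 ⟨p - mulNormSq r, ?_, mulNormSq r, ⟨r, rfl⟩, sub_add_cancel _ _⟩
  rw [LinearMap.mem_ker, map_sub, sub_eq_zero]
  exact hr.symm

/-- The harmonic projection `(p)₀`: the component `h₀` in the decomposition
`p = h₀ + q h₁ + q² h₂ + ⋯` with all `hⱼ` harmonic. -/
def harmProj : Poly3 →ₗ[ℝ] Poly3 := Submodule.projection _ _ isCompl_harmonic

/-- `harmProj` does read off the component `h₀` of the harmonic decomposition. -/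
theorem harmProj_decomposition (r : ℕ) (h : ℕ → Poly3) (hh : ∀ j, laplacian (h j) = 0) :
    harmProj (∑ j ∈ Finset.range (r + 1), normSq ^ j * h j) = h 0 := by
  rw [Finset.sum_range_succ', map_add, pow_zero, one_mul]
  have h1 : harmProj (h 0) = h 0 :=
    Submodule.projection_apply_of_mem_left _ (LinearMap.mem_ker.2 (hh 0))
  have h2 : harmProj (∑ j ∈ Finset.range r, normSq ^ (j + 1) * h (j + 1)) = 0 := by
    refine (Submodule.projection_apply_eq_zero_iff _).2
      ⟨∑ j ∈ Finset.range r, normSq ^ j * h (j + 1), ?_⟩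
    rw [mulNormSq_apply, Finset.mul_sum]
    exact Finset.sum_congr rfl fun j _ => by ring
  rw [h1, h2, zero_add]

/-- The harmonic product `h₁ ∗ h₂ = (h₁ h₂)₀` of polynomials. -/
def harmMul (h₁ h₂ : Poly3) : Poly3 := harmProj (h₁ * h₂)

/-- The iterated harmonic product `h₁ ∗ ⋯ ∗ h_k`, bracketed as `((1 ∗ h₁) ∗ h₂) ∗ ⋯ ∗ h_k`,
where `1` is the unit of the product. -/
def harmProd : (k : ℕ) → (Fin k → Poly3) → Poly3
  | 0, _ => 1
  | k + 1, h => harmMul (harmProd k (Fin.init h)) (h (Fin.last k))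

/-! ## Harmonic tensors on `ℝ³` and their product -/

/-- The Euclidean space `ℝ³`. -/
abbrev E3 : Type := EuclideanSpace ℝ (Fin 3)

/-- The canonical orthonormal basis of `ℝ³`. -/
def stdVec (i : Fin 3) : E3 := EuclideanSpace.basisFun (Fin 3) ℝ i

/-- `n`-th order tensors: `n`-linear forms on `ℝ³`. -/
abbrev Tensor (n : ℕ) : Type := MultilinearMap ℝ (fun _ : Fin n => E3) ℝ

/-- The action of permutations, `(σ ⋆ T)(x₁, …, xₙ) = T(x_{σ⁻¹(1)}, …, x_{σ⁻¹(n)})`. -/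
def permAct {n : ℕ} (σ : Equiv.Perm (Fin n)) : Tensor n →ₗ[ℝ] Tensor n :=
  (MultilinearMap.domDomCongrLinearEquiv ℝ ℝ E3 ℝ σ⁻¹).toLinearMap

theorem permAct_apply {n : ℕ} (σ : Equiv.Perm (Fin n)) (T : Tensor n) (x : Fin n → E3) :
    permAct σ T x = T fun i => x (σ⁻¹ i) := rfl

/-- The space of totally symmetric tensors of order `n`. -/
def SymTensor (n : ℕ) : Submodule ℝ (Tensor n) where
  carrier := {T | ∀ σ : Equiv.Perm (Fin n), permAct σ T = T}
  zero_mem' := fun σ => map_zero _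
  add_mem' := fun {S T} hS hT σ => by rw [map_add, hS σ, hT σ]
  smul_mem' := fun c T hT σ => by rw [map_smul, hT σ]

/-- Contraction of the first two indices: `(x₁, …, xₙ) ↦ ∑ i, T(eᵢ, eᵢ, x₁, …, xₙ)`. On totally
symmetric tensors this is the trace (any two indices give the same result). -/
def contract {n : ℕ} (T : Tensor (n + 2)) : Tensor n :=
  ∑ i : Fin 3, MultilinearMap.curryLeft (MultilinearMap.curryLeft T (stdVec i)) (stdVec i)

theorem contract_apply {n : ℕ} (T : Tensor (n + 2)) (x : Fin n → E3) :
    contract T x = ∑ i : Fin 3, T (Fin.cons (stdVec i) (Fin.cons (stdVec i) x)) := by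
  simp [contract]

theorem contract_add {n : ℕ} (S T : Tensor (n + 2)) :
    contract (S + T) = contract S + contract T := by
  ext x
  simp [contract_apply, Finset.sum_add_distrib]

theorem contract_smul {n : ℕ} (c : ℝ) (T : Tensor (n + 2)) :
    contract (c • T) = c • contract T := by
  ext x
  simp [contract_apply, Finset.mul_sum]

/-- Trace-free tensors (no condition in orders `0` and `1`). -/
def TraceFree : (n : ℕ) → Submodule ℝ (Tensor n)
  | 0 => ⊤
  | 1 => ⊤
  | n + 2 =>
    { carrier := {T | contract T = 0}
      zero_mem' := by
        have h := contract_smul (n := n) 0 0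
        simpa using h
      add_mem' := fun {S T} hS hT => by
        rw [Set.mem_ofPred_eq] at *
        rw [contract_add, hS, hT, add_zero]
      smul_mem' := fun c T hT => by
        rw [Set.mem_ofPred_eq] at *
        rw [contract_smul, hT, smul_zero] }

/-- The space of harmonic tensors of order `n`: totally symmetric with vanishing trace. For `n = 2`
these are the symmetric deviatoric tensors. -/
def HarmTensor (n : ℕ) : Submodule ℝ (Tensor n) := SymTensor n ⊓ TraceFree n

/-- The Euclidean scalar product of tensors,
`S · T = ∑ S(e_{i₁}, …, e_{iₙ}) T(e_{i₁}, …, e_{iₙ})`. -/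
def tensorInner (n : ℕ) : LinearMap.BilinForm ℝ (Tensor n) :=
  LinearMap.mk₂ ℝ
    (fun S T => ∑ ι : Fin n → Fin 3, S (fun j => stdVec (ι j)) * T (fun j => stdVec (ι j)))
    (fun S S' T => by simp [add_mul, Finset.sum_add_distrib])
    (fun c S T => by simp [Finset.mul_sum, mul_assoc])
    (fun S T T' => by simp [mul_add, Finset.sum_add_distrib])
    (fun c S T => by simp [Finset.mul_sum, mul_left_comm])

theorem tensorInner_apply {n : ℕ} (S T : Tensor n) :
    tensorInner n S T =
      ∑ ι : Fin n → Fin 3, S (fun j => stdVec (ι j)) * T (fun j => stdVec (ι j)) := rfl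

theorem eq_zero_of_tensorInner_self {n : ℕ} {T : Tensor n} (h : tensorInner n T T = 0) :
    T = 0 := by
  rw [tensorInner_apply, Finset.sum_eq_zero_iff_of_nonneg fun _ _ => mul_self_nonneg _] at h
  refine Module.Basis.ext_multilinear (fun _ => (EuclideanSpace.basisFun (Fin 3) ℝ).toBasis)
    fun ι => ?_
  have h1 := mul_self_eq_zero.1 (h ι (Finset.mem_univ _))
  simpa [stdVec] using h1

theorem isCompl_harmTensor (n : ℕ) :
    IsCompl (HarmTensor n) ((tensorInner n).orthogonal (HarmTensor n)) := by
  have hsymm : (tensorInner n).IsSymm := ⟨fun S T => by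
    simp [tensorInner_apply, mul_comm]⟩
  refine LinearMap.BilinForm.isCompl_orthogonal_of_restrict_nondegenerate hsymm.isRefl ?_
  constructor
  · intro x hx
    exact Subtype.ext (eq_zero_of_tensorInner_self (hx x))
  · intro x hx
    exact Subtype.ext (eq_zero_of_tensorInner_self (hx x))

/-- The harmonic part `(T)₀`: the orthogonal projection of `T` onto the harmonic tensors. -/
def tensorHarmProj (n : ℕ) : Tensor n →ₗ[ℝ] Tensor n :=
  Submodule.projection _ _ (isCompl_harmTensor n)

/-- The tensor product `T₁ ⊗ T₂`. -/
def tensorMul {m n : ℕ} (T₁ : Tensor m) (T₂ : Tensor n) : Tensor (m + n) :=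
  MultilinearMap.domDomCongr finSumFinEquiv
    ((LinearMap.mul' ℝ ℝ).compMultilinearMap (MultilinearMap.domCoprod T₁ T₂))

theorem tensorMul_apply {m n : ℕ} (T₁ : Tensor m) (T₂ : Tensor n) (x : Fin (m + n) → E3) :
    tensorMul T₁ T₂ x =
      T₁ (fun i => x (Fin.castAdd n i)) * T₂ (fun j => x (Fin.natAdd m j)) := by
  simp [tensorMul, MultilinearMap.domCoprod]

/-- The symmetric tensor product `T₁ ⊙ T₂ = (1 / (m + n)!) ∑ σ, σ ⋆ (T₁ ⊗ T₂)`. -/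
def symMul {m n : ℕ} (T₁ : Tensor m) (T₂ : Tensor n) : Tensor (m + n) :=
  (((m + n).factorial : ℝ)⁻¹) • ∑ σ : Equiv.Perm (Fin (m + n)), permAct σ (tensorMul T₁ T₂)

/-- The harmonic product `H₁ ∗ H₂ = (H₁ ⊙ H₂)₀` of tensors. -/
def tensorHarmMul {m n : ℕ} (H₁ : Tensor m) (H₂ : Tensor n) : Tensor (m + n) :=
  tensorHarmProj (m + n) (symMul H₁ H₂)

/-- The iterated harmonic product `H₁ ∗ ⋯ ∗ H_k` of tensors of order `n`, bracketed as
`((1 ∗ H₁) ∗ H₂) ∗ ⋯ ∗ H_k`, where the tensor `1` of order `0` is the unit of the product. -/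
def tensorHarmProd {n : ℕ} : (k : ℕ) → (Fin k → Tensor n) → Tensor (n * k)
  | 0, _ => MultilinearMap.constOfIsEmpty ℝ (fun _ : Fin 0 => E3) (1 : ℝ)
  | k + 1, H => tensorHarmMul (tensorHarmProd k (Fin.init H)) (H (Fin.last k))

end HarmonicFactorization

end

open HarmonicFactorization

noncomputable section

namespace HarmonicFactorization

open MvPolynomial

/-! ## Binary forms with the antipodal real structure -/

/-! Modulo `q`, a polynomial is determined by its restriction to the complex cone `q = 0`, which
`conePoint` parametrizes by quadratics in `t`. A real form of degree `N` thus becomes a polynomial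
of formal degree `2N`, and realness becomes symmetry under the antipodal map `t ↦ -1 / conj t` of
the Riemann sphere. That map has no fixed point, so the roots split into `N` antipodal pairs
(`IsAntipodal.exists_eq_prod`), and each pair is cut out by a real linear form
(`coneRestrict_rootForm`). Hence the form agrees on the cone with a real multiple of a product of
`N` real linear forms, and the difference is a multiple of `q`
(`normSq_dvd_of_coneRestrict_eq_zero`).

Since `harmProj` has kernel the multiples of `q`, the harmonic product is multiplication modulo `q`.
Grouping the `kn` linear forms into `k` blocks of `n` and projecting each block gives the factors.

For tensors, `toPoly` identifies symmetric tensors with forms and turns the scalar product into the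
apolar pairing up to `n!`, so it carries one harmonic projection, hence one harmonic product, to the
other. -/

open Polynomial in
/-- The polynomial `t ↦ (-t²)ᴺ P(-1/t)`, for `P` of degree at most `2N`. -/
def antipode (N : ℕ) (P : ℂ[X]) : ℂ[X] :=
  Polynomial.C ((-1) ^ N) * Polynomial.reflect (2 * N) (P.comp (-Polynomial.X))

theorem natDegree_comp_neg_X (P : Polynomial ℂ) :
    (P.comp (-Polynomial.X)).natDegree = P.natDegree := by
  rw [Polynomial.natDegree_comp, Polynomial.natDegree_neg, Polynomial.natDegree_X, mul_one]

theorem eval_antipode {N : ℕ} {P : Polynomial ℂ} (hP : P.natDegree ≤ 2 * N) {s : ℂ}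
    (hs : s ≠ 0) : (antipode N P).eval s = (-s ^ 2) ^ N * P.eval (-s⁻¹) := by
  have : Invertible s⁻¹ := invertibleOfNonzero (inv_ne_zero hs)
  have h := Polynomial.eval₂_reflect_mul_pow (RingHom.id ℂ) s⁻¹ (2 * N)
    (P.comp (-Polynomial.X)) (by rwa [natDegree_comp_neg_X])
  simp only [invOf_eq_inv, inv_inv, Polynomial.eval₂_id, Polynomial.eval_comp,
    Polynomial.eval_neg, Polynomial.eval_X] at h
  rw [antipode, Polynomial.eval_mul, Polynomial.eval_C, ← h, neg_pow (s ^ 2), ← pow_mul, inv_pow]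
  field_simp

theorem antipode_mul {M N : ℕ} {P Q : Polynomial ℂ} (hP : P.natDegree ≤ 2 * M)
    (hQ : Q.natDegree ≤ 2 * N) :
    antipode (M + N) (P * Q) = antipode M P * antipode N Q := by
  rw [antipode, Polynomial.mul_comp, mul_add, Polynomial.reflect_mul _ _
    (by rwa [natDegree_comp_neg_X]) (by rwa [natDegree_comp_neg_X]), pow_add, map_mul,
    antipode, antipode]
  ring

theorem polynomial_eq_of_eval_eq_of_ne_zero {P Q : Polynomial ℂ}
    (h : ∀ s : ℂ, s ≠ 0 → P.eval s = Q.eval s) : P = Q := by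
  refine Polynomial.eq_of_infinite_eval_eq P Q (Set.Infinite.mono (s := {0}ᶜ) (fun s hs => h s hs) ?_)
  exact (Set.finite_singleton (0 : ℂ)).infinite_compl

/-- The complex polynomials of formal degree `2N` fixed by the antipodal real structure. -/
structure IsAntipodal (N : ℕ) (P : Polynomial ℂ) : Prop where
  natDegree_le : P.natDegree ≤ 2 * N
  antipode_eq : antipode N P = P.map (starRingEnd ℂ)

theorem isAntipodal_iff_eval {N : ℕ} {P : Polynomial ℂ} (hP : P.natDegree ≤ 2 * N) :
    IsAntipodal N P ↔ ∀ s : ℂ, s ≠ 0 →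
      (-s ^ 2) ^ N * P.eval (-s⁻¹) = starRingEnd ℂ (P.eval (starRingEnd ℂ s)) := by
  have hmap : ∀ s : ℂ, (P.map (starRingEnd ℂ)).eval s =
      starRingEnd ℂ (P.eval (starRingEnd ℂ s)) := fun s => by
    conv_lhs => rw [← Complex.conj_conj s]
    rw [Polynomial.eval_map, Polynomial.eval₂_hom]
  constructor
  · intro h s hs
    rw [← eval_antipode hP hs, h.antipode_eq, hmap]
  · intro h
    refine ⟨hP, polynomial_eq_of_eval_eq_of_ne_zero fun s hs => ?_⟩
    rw [eval_antipode hP hs, h s hs, hmap]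

/-- The antipodal map exchanges the roots `0` and `∞`: the top coefficient of `antipode N P` is
`(-1)^N P(0)`. -/
theorem IsAntipodal.coeff_zero_eq_zero_iff {N : ℕ} {P : Polynomial ℂ} (h : IsAntipodal N P) :
    P.coeff 0 = 0 ↔ P.coeff (2 * N) = 0 := by
  have h1 := congrArg (fun Q : Polynomial ℂ => Q.coeff (2 * N)) h.antipode_eq
  simp only [antipode, Polynomial.coeff_C_mul, Polynomial.coeff_reflect, Polynomial.coeff_map,
    Polynomial.revAt_le le_rfl, Nat.sub_self, Polynomial.coeff_zero_eq_eval_zero,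
    Polynomial.eval_comp, Polynomial.eval_neg, Polynomial.eval_X, neg_zero] at h1
  rw [Polynomial.coeff_zero_eq_eval_zero]
  constructor
  · intro h0
    rw [h0, mul_zero] at h1
    exact (map_eq_zero _).1 h1.symm
  · intro h0
    rw [h0, map_zero] at h1
    exact (mul_eq_zero.1 h1).resolve_left (pow_ne_zero _ (by norm_num))

/-- The antipodal quadratic form with roots `α` and `-1 / conj α`. -/
def antipodalPair (α : ℂ) : Polynomial ℂ :=
  (Polynomial.X - Polynomial.C α) * (Polynomial.C (starRingEnd ℂ α) * Polynomial.X + 1)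

theorem natDegree_antipodalPair_le (α : ℂ) : (antipodalPair α).natDegree ≤ 2 * 1 := by
  unfold antipodalPair
  compute_degree

theorem isAntipodal_antipodalPair (α : ℂ) : IsAntipodal 1 (antipodalPair α) := by
  rw [isAntipodal_iff_eval (natDegree_antipodalPair_le α)]
  intro s hs
  simp only [antipodalPair, Polynomial.eval_mul, Polynomial.eval_sub, Polynomial.eval_X,
    Polynomial.eval_C, Polynomial.eval_add, Polynomial.eval_one, map_mul, map_sub, map_add,
    map_one, Complex.conj_conj]
  field_simp
  ring

/-- This is the absence of fixed points: `α = -1 / conj α` would force `|α|² = -1`. -/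
theorem mul_conj_ne_neg_one (α : ℂ) : α * starRingEnd ℂ α ≠ -1 := by
  rw [Complex.mul_conj]
  intro h
  have h1 := congrArg Complex.re h
  simp only [Complex.ofReal_re, Complex.neg_re, Complex.one_re] at h1
  linarith [Complex.normSq_nonneg α]

theorem antipodalPair_ne_zero (α : ℂ) : antipodalPair α ≠ 0 := by
  refine mul_ne_zero (Polynomial.X_sub_C_ne_zero α) fun h => ?_
  simpa using congrArg (Polynomial.eval 0) h

/-- `antipode` is multiplicative, so the nonzero antipodal factor cancels. -/
theorem IsAntipodal.of_antipodalPair_mul {N : ℕ} {α : ℂ} {R : Polynomial ℂ}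
    (h : IsAntipodal (1 + N) (antipodalPair α * R)) (hR : R.natDegree ≤ 2 * N) :
    IsAntipodal N R := by
  refine ⟨hR, ?_⟩
  have h1 := h.antipode_eq
  rw [antipode_mul (natDegree_antipodalPair_le α) hR, Polynomial.map_mul,
    (isAntipodal_antipodalPair α).antipode_eq] at h1
  refine mul_left_cancel₀ ?_ h1
  exact (Polynomial.map_ne_zero_iff (starRingEnd ℂ).injective).2 (antipodalPair_ne_zero α)

theorem IsAntipodal.exists_eq_antipodalPair_mul {N : ℕ} {P : Polynomial ℂ}
    (h : IsAntipodal (1 + N) P) :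
    ∃ α R, P = antipodalPair α * R ∧ IsAntipodal N R := by
  -- A vanishing top coefficient means a root at `∞`, hence one at `0`; this pair is `antipodalPair
  -- 0 = X`.
  by_cases h0 : P.coeff (2 * (1 + N)) = 0
  · obtain ⟨R, rfl⟩ := Polynomial.X_dvd_iff.2 (h.coeff_zero_eq_zero_iff.2 h0)
    have hX : antipodalPair 0 = Polynomial.X := by simp [antipodalPair]
    refine ⟨0, R, by rw [hX], IsAntipodal.of_antipodalPair_mul (α := 0) (by rwa [hX]) ?_⟩
    rcases eq_or_ne R 0 with rfl | hR
    · simp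
    have h1 := h.natDegree_le
    rw [Polynomial.natDegree_X_mul hR] at h1
    -- Dividing by `X` lowers the degree by one only; the second unit comes from the vanishing top
    -- coefficient.
    have h2 : R.natDegree ≠ 2 * N + 1 := by
      intro h2
      rw [show 2 * (1 + N) = R.natDegree + 1 by omega, Polynomial.coeff_X_mul] at h0
      exact hR (Polynomial.leadingCoeff_eq_zero.1 h0)
    omega
  · have hdeg : P.natDegree = 2 * (1 + N) :=
      le_antisymm h.natDegree_le (Polynomial.le_natDegree_of_ne_zero h0)
    obtain ⟨α, hα⟩ := Complex.exists_root (f := P)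
      (Polynomial.natDegree_pos_iff_degree_pos.1 (by omega))
    have hα0 : α ≠ 0 := by
      rintro rfl
      exact h0 (h.coeff_zero_eq_zero_iff.1 (by rwa [Polynomial.coeff_zero_eq_eval_zero]))
    have hc0 : starRingEnd ℂ α ≠ 0 := (map_ne_zero _).2 hα0
    have hβ : P.IsRoot (-(starRingEnd ℂ α)⁻¹) := by
      have h1 := (isAntipodal_iff_eval h.natDegree_le).1 h _ hc0
      rw [Complex.conj_conj, hα.eq_zero, map_zero] at h1
      exact (mul_eq_zero.1 h1).resolve_left (pow_ne_zero _ (neg_ne_zero.2 (pow_ne_zero _ hc0)))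
    have hne : α - -(starRingEnd ℂ α)⁻¹ ≠ 0 := by
      intro h1
      apply mul_conj_ne_neg_one α
      field_simp at h1
      linear_combination h1
    obtain ⟨R, hR⟩ := (Polynomial.isCoprime_X_sub_C_of_isUnit_sub hne.isUnit).mul_dvd
      (Polynomial.dvd_iff_isRoot.2 hα) (Polynomial.dvd_iff_isRoot.2 hβ)
    -- `antipodalPair α` has leading coefficient `conj α`, which the quotient must compensate.
    have hPR : P = antipodalPair α * (Polynomial.C (starRingEnd ℂ α)⁻¹ * R) := by
      have h2 : (1 : Polynomial ℂ) =
          Polynomial.C (starRingEnd ℂ α) * Polynomial.C (starRingEnd ℂ α)⁻¹ := by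
        rw [← map_mul, mul_inv_cancel₀ hc0, map_one]
      rw [hR, antipodalPair, map_neg]
      linear_combination (Polynomial.X - Polynomial.C α) * R * (-Polynomial.X) * (-h2)
    refine ⟨α, _, hPR, IsAntipodal.of_antipodalPair_mul (hPR ▸ h) ?_⟩
    have hRne : R ≠ 0 := by
      rintro rfl
      rw [hR, mul_zero, Polynomial.natDegree_zero] at hdeg
      omega
    rw [hR, Polynomial.natDegree_mul (mul_ne_zero (Polynomial.X_sub_C_ne_zero _)
      (Polynomial.X_sub_C_ne_zero _)) hRne, Polynomial.natDegree_mul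
      (Polynomial.X_sub_C_ne_zero _) (Polynomial.X_sub_C_ne_zero _),
      Polynomial.natDegree_X_sub_C, Polynomial.natDegree_X_sub_C] at hdeg
    rw [Polynomial.natDegree_C_mul (inv_ne_zero hc0)]
    omega

theorem IsAntipodal.exists_eq_prod {N : ℕ} {P : Polynomial ℂ} (h : IsAntipodal N P) :
    ∃ (c : ℝ) (α : Fin N → ℂ), P = Polynomial.C (c : ℂ) * ∏ i, antipodalPair (α i) := by
  induction N generalizing P with
  | zero =>
    have h1 := Polynomial.eq_C_of_natDegree_le_zero h.natDegree_le
    -- In formal degree `0` the symmetry says that the constant equals its conjugate.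
    have h2 := (isAntipodal_iff_eval h.natDegree_le).1 h 1 one_ne_zero
    rw [h1] at h2
    simp only [Polynomial.eval_C, pow_zero, one_mul] at h2
    obtain ⟨c, hc⟩ := Complex.conj_eq_iff_real.1 h2.symm
    exact ⟨c, Fin.elim0, by rw [h1, hc]; simp⟩
  | succ N ih =>
    rw [add_comm] at h
    obtain ⟨α, R, rfl, hR⟩ := h.exists_eq_antipodalPair_mul
    obtain ⟨c, β, rfl⟩ := ih hR
    refine ⟨c, Fin.cons α β, ?_⟩
    rw [Fin.prod_univ_succ]
    simp only [Fin.cons_zero, Fin.cons_succ]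
    ring

/-! ## Restriction of polynomials to the isotropic cone -/

/-- The parametrization `t ↦ (i(1 + t²), 1 - t², 2t)` of the isotropic cone. -/
def conePoint : Fin 3 → Polynomial ℂ :=
  ![Polynomial.C Complex.I * (1 + Polynomial.X ^ 2), 1 - Polynomial.X ^ 2, 2 * Polynomial.X]

/-- The restriction of a polynomial to the isotropic cone. -/
def coneRestrict : Poly3 →ₐ[ℝ] Polynomial ℂ := aeval conePoint

theorem natDegree_conePoint_le (i : Fin 3) : (conePoint i).natDegree ≤ 2 := by
  fin_cases i <;> simp [conePoint] <;> compute_degree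

theorem eval_coneRestrict (p : Poly3) (s : ℂ) :
    (coneRestrict p).eval s = aeval (fun i => (conePoint i).eval s) p := by
  have h : ((Polynomial.aeval s).restrictScalars ℝ).comp coneRestrict =
      (aeval (fun i => (conePoint i).eval s) : Poly3 →ₐ[ℝ] ℂ) := by
    ext i
    simp [coneRestrict]
  simpa using DFunLike.congr_fun h p

theorem aeval_mul_of_isHomogeneous {p : Poly3} {N : ℕ} (hp : p.IsHomogeneous N) (c : ℂ)
    (v : Fin 3 → ℂ) : aeval (fun i => c * v i) p = c ^ N * aeval v p := by
  rw [aeval_def, aeval_def, eval₂_eq, eval₂_eq, Finset.mul_sum]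
  refine Finset.sum_congr rfl fun m hm => ?_
  have h1 : ∑ i ∈ m.support, m i = N := (hp.degree_eq_sum_deg_support hm).symm
  simp only [mul_pow, Finset.prod_mul_distrib, Finset.prod_pow_eq_pow_sum, h1]
  ring

theorem conj_aeval (p : Poly3) (v : Fin 3 → ℂ) :
    starRingEnd ℂ (aeval v p) = aeval (fun i => starRingEnd ℂ (v i)) p := by
  have h : (Complex.conjAe : ℂ →ₐ[ℝ] ℂ).comp (aeval v) =
      (aeval (fun i => starRingEnd ℂ (v i)) : Poly3 →ₐ[ℝ] ℂ) := by
    ext i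
    simp
  simpa using DFunLike.congr_fun h p

theorem natDegree_coneRestrict_le {p : Poly3} {N : ℕ} (hp : p.IsHomogeneous N) :
    (coneRestrict p).natDegree ≤ 2 * N := by
  rw [coneRestrict, aeval_def, eval₂_eq]
  refine Polynomial.natDegree_sum_le_of_forall_le _ _ fun m hm => ?_
  have h1 : ∑ i ∈ m.support, m i = N := (hp.degree_eq_sum_deg_support hm).symm
  refine (Polynomial.natDegree_C_mul_le _ _).trans ?_
  refine (Polynomial.natDegree_prod_le _ _).trans ?_
  rw [← h1, Finset.mul_sum]
  refine Finset.sum_le_sum fun i _ => Polynomial.natDegree_pow_le.trans ?_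
  rw [mul_comm]
  exact Nat.mul_le_mul_right _ (natDegree_conePoint_le i)

/-- The vector `-s² • conePoint(-1/s)` is the conjugate of `conePoint(conj s)`. Homogeneity extracts
the factor `(-s²)^N`, and real coefficients let conjugation pass through `p`. -/
theorem isAntipodal_coneRestrict {p : Poly3} {N : ℕ} (hp : p.IsHomogeneous N) :
    IsAntipodal N (coneRestrict p) := by
  rw [isAntipodal_iff_eval (natDegree_coneRestrict_le hp)]
  intro s hs
  rw [eval_coneRestrict, eval_coneRestrict, conj_aeval, ← aeval_mul_of_isHomogeneous hp]
  congr 2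
  funext i
  fin_cases i <;> simp [conePoint, map_ofNat] <;> field_simp <;> ring

/-- The real linear form whose restriction to the isotropic cone has roots `α` and
`-1 / conj α`. -/
def rootForm (α : ℂ) : Poly3 :=
  C (-α.im) * X 0 + C (-α.re) * X 1 + C ((1 - Complex.normSq α) / 2) * X 2

theorem isHomogeneous_rootForm (α : ℂ) : (rootForm α).IsHomogeneous 1 := by
  have h : ∀ (a : ℝ) (i : Fin 3), (C a * X i : Poly3).IsHomogeneous 1 := fun a i => by
    simpa using (isHomogeneous_C (Fin 3) a).mul (isHomogeneous_X ℝ i)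
  exact ((h _ _).add (h _ _)).add (h _ _)

/-- The pair expands to `conj α t² + (1 - |α|²) t - α`; matching it with `i a (1 + t²) + b (1 - t²)
+ 2 c t` determines the real coefficients `a, b, c`. -/
theorem coneRestrict_rootForm (α : ℂ) : coneRestrict (rootForm α) = antipodalPair α := by
  obtain ⟨a, b⟩ := α
  refine Polynomial.funext fun s => ?_
  have h1 : (⟨a, b⟩ : ℂ) = a + b * Complex.I := Complex.mk_eq_add_mul_I a b
  have h2 : starRingEnd ℂ ⟨a, b⟩ = a - b * Complex.I := by
    rw [h1]
    simp [sub_eq_add_neg]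
  rw [eval_coneRestrict, rootForm, antipodalPair, h2, Complex.normSq_mk, h1]
  simp [conePoint]
  linear_combination (-(b : ℂ) ^ 2 * s) * Complex.I_sq

theorem exists_coneRestrict_eq_prod {p : Poly3} {N : ℕ} (hp : p.IsHomogeneous N) :
    ∃ (c : ℝ) (l : Fin N → Poly3), (∀ i, (l i).IsHomogeneous 1) ∧
      coneRestrict p = coneRestrict (C c * ∏ i, l i) := by
  obtain ⟨c, α, h⟩ := (isAntipodal_coneRestrict hp).exists_eq_prod
  refine ⟨c, fun i => rootForm (α i), fun i => isHomogeneous_rootForm _, ?_⟩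
  rw [h, map_mul, map_prod]
  simp only [coneRestrict_rootForm]
  congr 1
  simp [coneRestrict]

/-! ## Polynomials vanishing on the isotropic cone -/

/-- Division by `q`, which is monic of degree two in the first variable. -/
theorem exists_eq_normSq_mul_add (p : Poly3) :
    ∃ (s : Poly3) (a b : MvPolynomial (Fin 2) ℝ),
      p = normSq * s + (rename Fin.succ a + X 0 * rename Fin.succ b) := by
  induction p using MvPolynomial.induction_on with
  | C c => exact ⟨0, C c, 0, by simp⟩
  | add p r hp hr =>
    obtain ⟨s, a, b, hp⟩ := hp
    obtain ⟨s', a', b', hr⟩ := hr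
    refine ⟨s + s', a + a', b + b', ?_⟩
    rw [map_add, map_add]
    linear_combination hp + hr
  | mul_X p i hp =>
    obtain ⟨s, a, b, hp⟩ := hp
    refine Fin.cases ?_ (fun j => ?_) i
    -- The term `x² b` is reduced by `x² = q - (y² + z²)`.
    · refine ⟨s * X 0 + rename Fin.succ b, -(X 0 ^ 2 + X 1 ^ 2) * b, a, ?_⟩
      rw [hp]
      simp [normSq, Fin.sum_univ_three]
      ring
    · refine ⟨s * X j.succ, a * X j, b * X j, ?_⟩
      rw [hp, map_mul, map_mul, rename_X]
      ring

/-- The point lies on the parametrized cone: it is `(w + x) / 2` times the point of parameter `t = z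
/ (w + x)`. -/
theorem aeval_eq_zero_of_coneRestrict_eq_zero {p : Poly3} {N : ℕ} (hp : p.IsHomogeneous N)
    (h : coneRestrict p = 0) {w x z : ℝ} (hz : z ≠ 0) (hw : w ^ 2 = x ^ 2 + z ^ 2) :
    aeval (![Complex.I * w, x, z] : Fin 3 → ℂ) p = 0 := by
  have hwx : w + x ≠ 0 := by
    intro h0
    have : z ^ 2 = 0 := by linear_combination (w - x) * h0 - hw
    exact hz (pow_eq_zero_iff two_ne_zero |>.1 this)
  have hwx' : (w : ℂ) + x ≠ 0 := by exact_mod_cast hwx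
  have hw' : (w : ℂ) ^ 2 = x ^ 2 + z ^ 2 := by exact_mod_cast hw
  have hv : (![Complex.I * w, x, z] : Fin 3 → ℂ) =
      fun i => ((w + x) / 2 : ℂ) * (conePoint i).eval ((z : ℂ) / (w + x)) := by
    funext i
    fin_cases i
    · simp [conePoint]
      field_simp
      linear_combination hw'
    · simp [conePoint]
      field_simp
      linear_combination -hw'
    · simp [conePoint]
      field_simp
  rw [hv, aeval_mul_of_isHomogeneous hp, ← eval_coneRestrict, h, Polynomial.eval_zero, mul_zero]

theorem eq_zero_of_eval_eq_zero_of_ne_zero {a : MvPolynomial (Fin 2) ℝ}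
    (h : ∀ x z : ℝ, z ≠ 0 → eval ![x, z] a = 0) : a = 0 := by
  have h1 : X 1 * a = 0 := by
    refine MvPolynomial.funext fun v => ?_
    have hv : v = ![v 0, v 1] := by
      funext i
      fin_cases i <;> rfl
    rw [map_mul, eval_X, map_zero]
    by_cases h0 : v 1 = 0
    · rw [h0, zero_mul]
    · rw [hv, h _ _ h0, mul_zero]
  exact (mul_eq_zero.1 h1).resolve_left (X_ne_zero _)

/-- At the cone points `(iw, x, z)` with `w = √(x² + z²)`, the remainder `a + x₀ b` of division by
`q` takes the value `a(x, z) + i w b(x, z)`. Its real and imaginary parts vanish separately, which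
kills `a` and `b`. -/
theorem normSq_dvd_of_coneRestrict_eq_zero {p : Poly3} {N : ℕ} (hp : p.IsHomogeneous N)
    (h : coneRestrict p = 0) : normSq ∣ p := by
  obtain ⟨s, a, b, hab⟩ := exists_eq_normSq_mul_add p
  have key : ∀ x z : ℝ, z ≠ 0 → eval ![x, z] a = 0 ∧ eval ![x, z] b = 0 := by
    intro x z hz
    have hpos : 0 < x ^ 2 + z ^ 2 := by positivity
    set w := Real.sqrt (x ^ 2 + z ^ 2) with hw
    have hw2 : w ^ 2 = x ^ 2 + z ^ 2 := Real.sq_sqrt hpos.le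
    have hw0 : w ≠ 0 := (Real.sqrt_pos.2 hpos).ne'
    have h1 := aeval_eq_zero_of_coneRestrict_eq_zero hp h hz hw2
    have hr : ∀ r : MvPolynomial (Fin 2) ℝ,
        aeval (![Complex.I * w, x, z] : Fin 3 → ℂ) (rename Fin.succ r) =
          ((eval ![x, z] r : ℝ) : ℂ) := by
      intro r
      have hc : ((![Complex.I * w, x, z] : Fin 3 → ℂ) ∘ Fin.succ) =
          (algebraMap ℝ ℂ) ∘ (![x, z] : Fin 2 → ℝ) := by
        funext i
        fin_cases i <;> rfl
      rw [aeval_rename, hc, aeval_algebraMap_apply]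
      simp [aeval_eq_eval]
    have hq : aeval (![Complex.I * w, x, z] : Fin 3 → ℂ) normSq = 0 := by
      have hw' : (w : ℂ) ^ 2 = x ^ 2 + z ^ 2 := by exact_mod_cast hw2
      simp [normSq, Fin.sum_univ_three]
      linear_combination (w : ℂ) ^ 2 * Complex.I_sq - hw'
    rw [hab, map_add, map_mul, hq, zero_mul, zero_add, map_add, map_mul, hr, hr, aeval_X] at h1
    have hre := congrArg Complex.re h1
    have him := congrArg Complex.im h1
    simp at hre him
    exact ⟨hre, him.resolve_left hw0⟩
  rw [hab, eq_zero_of_eval_eq_zero_of_ne_zero fun x z hz => (key x z hz).1,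
    eq_zero_of_eval_eq_zero_of_ne_zero fun x z hz => (key x z hz).2]
  simp

/-! ## The harmonic projection modulo `q` -/

theorem harmProj_eq_zero_iff {p : Poly3} : harmProj p = 0 ↔ normSq ∣ p := by
  rw [harmProj, Submodule.projection_apply_eq_zero_iff]
  constructor
  · rintro ⟨r, rfl⟩
    exact ⟨r, rfl⟩
  · rintro ⟨r, rfl⟩
    exact ⟨r, rfl⟩

theorem harmProj_eq_iff {p r : Poly3} : harmProj p = harmProj r ↔ normSq ∣ p - r := by
  rw [← harmProj_eq_zero_iff, map_sub, sub_eq_zero]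

theorem harmProj_of_laplacian_eq_zero {p : Poly3} (hp : laplacian p = 0) : harmProj p = p :=
  Submodule.projection_apply_of_mem_left _ (LinearMap.mem_ker.2 hp)

theorem laplacian_harmProj (p : Poly3) : laplacian (harmProj p) = 0 :=
  LinearMap.mem_ker.1 (Submodule.projection_apply_mem _ p)

theorem normSq_dvd_sub_harmProj (p : Poly3) : normSq ∣ p - harmProj p := by
  rw [← harmProj_eq_iff, harmProj_of_laplacian_eq_zero (laplacian_harmProj p)]

theorem isHomogeneous_normSq : normSq.IsHomogeneous 2 :=
  IsHomogeneous.sum _ _ _ fun i _ => isHomogeneous_X_pow i 2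

theorem isHomogeneous_laplacian {p : Poly3} {n : ℕ} (hp : p.IsHomogeneous (n + 2)) :
    (laplacian p).IsHomogeneous n := by
  rw [laplacian_apply]
  exact IsHomogeneous.sum _ _ _ fun i _ => (hp.pderiv (i := i)).pderiv (i := i)

theorem exists_homogeneous_laplacian_normSq_mul_eq {p : Poly3} {n : ℕ} (hp : p.IsHomogeneous n) :
    ∃ r : Poly3, r.IsHomogeneous n ∧ laplacian (normSq * r) = p := by
  have : Module.Finite ℝ (homogeneousSubmodule (Fin 3) ℝ n) :=
    Module.Finite.iff_fg.2 (homogeneousSubmodule_fg _ _ n)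
  let L : homogeneousSubmodule (Fin 3) ℝ n →ₗ[ℝ] homogeneousSubmodule (Fin 3) ℝ n :=
    (laplacian ∘ₗ mulNormSq).restrict fun x hx => laplacian_normSq_mul_mem n hx
  have hL : Function.Injective L := by
    rw [injective_iff_map_eq_zero]
    intro x hx
    have h0 := Submodule.disjoint_def.1 disjoint_ker_laplacian (mulNormSq x.1)
      (LinearMap.mem_ker.2 (congrArg Subtype.val hx)) ⟨x.1, rfl⟩
    exact Subtype.ext ((mul_eq_zero.1 h0).resolve_left normSq_ne_zero)
  obtain ⟨r, hr⟩ := LinearMap.injective_iff_surjective.1 hL ⟨p, hp⟩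
  exact ⟨r.1, r.2, congrArg Subtype.val hr⟩

/-- Constants and linear forms are harmonic. In higher degree the multiple of `q` to subtract can be
chosen homogeneous, because `r ↦ Δ(q r)` is bijective on each degree. -/
theorem harmProj_mem_harmPoly {p : Poly3} {n : ℕ} (hp : p.IsHomogeneous n) :
    harmProj p ∈ HarmPoly n := by
  refine ⟨?_, LinearMap.mem_ker.2 (laplacian_harmProj p)⟩
  change (harmProj p).IsHomogeneous n
  match n, hp with
  | 0, hp =>
    rw [← totalDegree_zero_iff_isHomogeneous, totalDegree_eq_zero_iff_eq_C] at hp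
    rw [harmProj_of_laplacian_eq_zero]
    · rw [hp]
      exact isHomogeneous_C _ _
    · rw [hp, laplacian_apply]
      simp
  | 1, hp =>
    rw [harmProj_of_laplacian_eq_zero]
    · exact hp
    · rw [laplacian_apply]
      refine Finset.sum_eq_zero fun i _ => ?_
      have h := hp.pderiv (i := i)
      rw [← totalDegree_zero_iff_isHomogeneous, totalDegree_eq_zero_iff_eq_C] at h
      rw [h, pderiv_C]
  | n + 2, hp =>
    obtain ⟨r, hr, hlap⟩ := exists_homogeneous_laplacian_normSq_mul_eq (isHomogeneous_laplacian hp)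
    have h : harmProj p = p - normSq * r := by
      rw [← harmProj_of_laplacian_eq_zero (p := p - normSq * r), harmProj_eq_iff]
      · simp
      · rw [map_sub, hlap, sub_self]
    rw [h]
    refine hp.sub ?_
    rw [add_comm]
    exact isHomogeneous_normSq.mul hr

/-- Multiples of `q` form an ideal, so intermediate projections can be dropped. -/
theorem harmProj_harmProj_mul_harmProj (p r : Poly3) :
    harmProj (harmProj p * harmProj r) = harmProj (p * r) := by
  rw [harmProj_eq_iff]
  have h : harmProj p * harmProj r - p * r =
      -((p - harmProj p) * harmProj r + p * (r - harmProj r)) := by ring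
  rw [h, dvd_neg]
  exact dvd_add ((normSq_dvd_sub_harmProj p).mul_right _) ((normSq_dvd_sub_harmProj r).mul_left _)

theorem laplacian_one : laplacian 1 = 0 := by
  rw [laplacian_apply]
  simp

theorem harmProd_harmProj (k : ℕ) (g : Fin k → Poly3) :
    harmProd k (fun i => harmProj (g i)) = harmProj (∏ i, g i) := by
  induction k with
  | zero => simp [harmProd, harmProj_of_laplacian_eq_zero laplacian_one]
  | succ k ih =>
    rw [harmProd, harmMul, Fin.prod_univ_castSucc]
    have h : Fin.init (fun i => harmProj (g i)) = fun i : Fin k => harmProj (g i.castSucc) := rfl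
    rw [h, ih, harmProj_harmProj_mul_harmProj]

/-! ## Factorization of harmonic polynomials -/

theorem exists_harmProj_eq_harmProj_prod {p : Poly3} {N : ℕ} (hp : p.IsHomogeneous N) :
    ∃ (c : ℝ) (l : Fin N → Poly3), (∀ i, (l i).IsHomogeneous 1) ∧
      harmProj p = harmProj (C c * ∏ i, l i) := by
  obtain ⟨c, l, hl, h⟩ := exists_coneRestrict_eq_prod hp
  refine ⟨c, l, hl, harmProj_eq_iff.2 (normSq_dvd_of_coneRestrict_eq_zero (N := N) ?_ ?_)⟩
  · refine hp.sub ?_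
    simpa using (IsHomogeneous.prod Finset.univ l (fun _ => 1) fun i _ => hl i).C_mul c
  · rw [map_sub, h, sub_self]

theorem exists_eq_harmProd {n k : ℕ} (hk : 1 ≤ k) {h : Poly3} (hh : h ∈ HarmPoly (n * k)) :
    ∃ f : Fin k → Poly3, (∀ i, f i ∈ HarmPoly n) ∧ h = harmProd k f := by
  obtain ⟨c, l, hl, hc⟩ := exists_harmProj_eq_harmProj_prod
    ((mem_homogeneousSubmodule _ _).1 hh.1)
  rw [harmProj_of_laplacian_eq_zero (LinearMap.mem_ker.1 hh.2)] at hc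
  obtain ⟨k, rfl⟩ : ∃ j, k = j + 1 := ⟨k - 1, by omega⟩
  -- The linear forms are cut into blocks of `n`, and block `0` absorbs the scalar `c`; at least one
  -- block is needed for this.
  let g : Fin (k + 1) → Poly3 := fun i =>
    C (if i = 0 then c else 1) * ∏ j, l ((finProdFinEquiv (i, j)).cast (mul_comm _ _))
  refine ⟨fun i => harmProj (g i), fun i => harmProj_mem_harmPoly ?_, ?_⟩
  · simpa using (IsHomogeneous.prod Finset.univ
      (fun j : Fin n => l ((finProdFinEquiv (i, j)).cast (mul_comm _ _))) (fun _ => 1)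
      fun j _ => hl _).C_mul (if i = 0 then c else 1)
  · rw [harmProd_harmProj, hc, Finset.prod_mul_distrib, ← map_prod, Finset.prod_ite_eq']
    congr 2
    · simp
    · rw [← Fintype.prod_equiv (finProdFinEquiv.trans (finCongr (mul_comm (k + 1) n))) _ l
        fun x => rfl, Fintype.prod_prod_type]
      rfl

/-! ## The polynomial of a tensor -/

/-- The polynomial `T(𝐱, …, 𝐱)` of a tensor `T`. -/
def toPoly (n : ℕ) : Tensor n →ₗ[ℝ] Poly3 where
  toFun T := ∑ ι : Fin n → Fin 3, T (fun j => stdVec (ι j)) • ∏ j, X (ι j)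
  map_add' S T := by simp [add_smul, Finset.sum_add_distrib]
  map_smul' c T := by simp [Finset.smul_sum, mul_smul]

theorem toPoly_apply {n : ℕ} (T : Tensor n) :
    toPoly n T = ∑ ι : Fin n → Fin 3, T (fun j => stdVec (ι j)) • ∏ j, X (ι j) := rfl

theorem isHomogeneous_prod_X {n : ℕ} (ι : Fin n → Fin 3) :
    (∏ j, X (ι j) : Poly3).IsHomogeneous n := by
  simpa using IsHomogeneous.prod Finset.univ (fun j => (X (ι j) : Poly3)) (fun _ => 1)
    fun j _ => isHomogeneous_X ℝ (ι j)

theorem isHomogeneous_toPoly {n : ℕ} (T : Tensor n) : (toPoly n T).IsHomogeneous n := by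
  rw [toPoly_apply]
  refine IsHomogeneous.sum _ _ _ fun ι _ => ?_
  rw [smul_eq_C_mul]
  exact (isHomogeneous_prod_X ι).C_mul _

theorem toPoly_permAct {n : ℕ} (σ : Equiv.Perm (Fin n)) (T : Tensor n) :
    toPoly n (permAct σ T) = toPoly n T := by
  rw [toPoly_apply, toPoly_apply]
  refine Fintype.sum_equiv (σ.arrowCongr (Equiv.refl (Fin 3))) _ _ fun ι => ?_
  rw [permAct_apply, ← Equiv.prod_comp σ⁻¹ fun j => (X (ι j) : Poly3)]
  rfl

theorem toPoly_tensorMul {m n : ℕ} (S : Tensor m) (T : Tensor n) :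
    toPoly (m + n) (tensorMul S T) = toPoly m S * toPoly n T := by
  rw [toPoly_apply, toPoly_apply, toPoly_apply, Finset.sum_mul_sum, ← Fintype.sum_prod_type',
    ← Fintype.sum_equiv (Fin.appendEquiv m n) _ _ fun x => rfl]
  refine Finset.sum_congr rfl fun x _ => ?_
  rw [tensorMul_apply, Fin.prod_univ_add]
  simp [Fin.appendEquiv, smul_smul, mul_comm]

theorem toPoly_symMul {m n : ℕ} (S : Tensor m) (T : Tensor n) :
    toPoly (m + n) (symMul S T) = toPoly m S * toPoly n T := by
  rw [symMul, map_smul, map_sum]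
  simp only [toPoly_permAct, toPoly_tensorMul, Finset.sum_const, Finset.card_univ,
    Fintype.card_perm, Fintype.card_fin]
  rw [← Nat.cast_smul_eq_nsmul ℝ, smul_smul, inv_mul_cancel₀ (by positivity), one_smul]

theorem toPoly_one :
    toPoly 0 (MultilinearMap.constOfIsEmpty ℝ (fun _ : Fin 0 => E3) (1 : ℝ)) = 1 := by
  simp [toPoly_apply]

theorem toPoly_succ {n : ℕ} (T : Tensor (n + 1)) :
    toPoly (n + 1) T = ∑ i, X i * toPoly n (T.curryLeft (stdVec i)) := by
  rw [toPoly_apply, ← Fintype.sum_equiv (Fin.consEquiv fun _ => Fin 3) _ _ fun x => rfl,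
    Fintype.sum_prod_type]
  refine Finset.sum_congr rfl fun i _ => ?_
  rw [toPoly_apply, Finset.mul_sum]
  refine Finset.sum_congr rfl fun ι _ => ?_
  rw [Fin.prod_univ_succ, mul_smul_comm, MultilinearMap.curryLeft_apply]
  simp only [Fin.consEquiv, Equiv.coe_fn_mk, Fin.cons_zero, Fin.cons_succ]
  congr 2
  funext j
  refine Fin.cases rfl (fun j => rfl) j

/-! ## Symmetric tensors -/

theorem SymTensor.apply_comp {n : ℕ} {T : Tensor n} (hT : T ∈ SymTensor n)
    (σ : Equiv.Perm (Fin n)) (x : Fin n → E3) : T (fun i => x (σ i)) = T x := by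
  have h := DFunLike.congr_fun (hT σ⁻¹) x
  rwa [permAct_apply, inv_inv] at h

theorem SymTensor.curryLeft_mem {n : ℕ} {T : Tensor (n + 1)} (hT : T ∈ SymTensor (n + 1))
    (v : E3) : T.curryLeft v ∈ SymTensor n := by
  intro σ
  ext x
  rw [permAct_apply, MultilinearMap.curryLeft_apply, MultilinearMap.curryLeft_apply]
  -- This extends `σ` to `n + 1` indices by fixing the first.
  rw [← SymTensor.apply_comp hT (Equiv.Perm.decomposeFin.symm (0, σ))]
  congr 1
  funext j
  refine Fin.cases ?_ (fun j => ?_) j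
  · simp
  · simpa using congrArg x (σ.symm_apply_apply j)

theorem SymTensor.curryLeft_curryLeft_comm {n : ℕ} {T : Tensor (n + 2)}
    (hT : T ∈ SymTensor (n + 2)) (v w : E3) :
    (T.curryLeft v).curryLeft w = (T.curryLeft w).curryLeft v := by
  ext x
  simp only [MultilinearMap.curryLeft_apply]
  rw [← SymTensor.apply_comp hT (Equiv.swap 0 1)]
  congr 1
  funext j
  refine Fin.cases ?_ (fun j => Fin.cases ?_ (fun j => ?_) j) j
  · rw [Equiv.swap_apply_left]; rfl
  · rw [Fin.succ_zero_eq_one, Equiv.swap_apply_right]; rfl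
  · rw [Equiv.swap_apply_of_ne_of_ne (by simp) (by simp [Fin.ext_iff])]
    rfl

/-- Leibniz on `∑ Xₐ T(eₐ, 𝐱, …, 𝐱)`: differentiating `Xₐ` gives one copy of `T(eᵢ, 𝐱, …, 𝐱)`; the
other factor gives the remaining `n` by induction and symmetry. -/
theorem pderiv_toPoly {n : ℕ} {T : Tensor (n + 1)} (hT : T ∈ SymTensor (n + 1)) (i : Fin 3) :
    pderiv i (toPoly (n + 1) T) = ((n : ℝ) + 1) • toPoly n (T.curryLeft (stdVec i)) := by
  induction n with
  | zero =>
    have h : ∀ a, pderiv i (toPoly 0 (T.curryLeft (stdVec a))) = 0 := fun a => by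
      simp [toPoly_apply, smul_eq_C_mul]
    rw [toPoly_succ, map_sum]
    simp only [Derivation.leibniz, h, pderiv_X, smul_eq_mul]
    simp [Pi.single_apply]
  | succ n ih =>
    have h : ∀ a, pderiv i (toPoly (n + 1) (T.curryLeft (stdVec a))) =
        ((n : ℝ) + 1) • toPoly n ((T.curryLeft (stdVec i)).curryLeft (stdVec a)) := fun a => by
      rw [ih (SymTensor.curryLeft_mem hT _), SymTensor.curryLeft_curryLeft_comm hT]
    rw [toPoly_succ, map_sum]
    simp only [Derivation.leibniz, h, pderiv_X, smul_eq_mul, mul_smul_comm,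
      Finset.sum_add_distrib, ← Finset.smul_sum]
    rw [← toPoly_succ]
    simp [Pi.single_apply, add_smul]

theorem toPoly_contract {n : ℕ} {T : Tensor (n + 2)} (hT : T ∈ SymTensor (n + 2)) :
    laplacian (toPoly (n + 2) T) = (((n : ℝ) + 2) * (n + 1)) • toPoly n (contract T) := by
  rw [laplacian_apply, contract, map_sum, Finset.smul_sum]
  refine Finset.sum_congr rfl fun i _ => ?_
  rw [pderiv_toPoly hT, Derivation.map_smul, pderiv_toPoly (SymTensor.curryLeft_mem hT _), smul_smul]
  push_cast
  ring_nf

/-! ## The apolar pairing and the scalar product of tensors -/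

theorem fischer_sub (p r : Poly3) : fischer (p - r) = fischer p - fischer r := by
  refine (basisMonomials (Fin 3) ℝ).ext fun m => ?_
  simp only [coe_basisMonomials, LinearMap.sub_apply, fischer_monomial, coeff_sub]
  ring

theorem fischer_smul (c : ℝ) (p : Poly3) : fischer (c • p) = c • fischer p := by
  refine (basisMonomials (Fin 3) ℝ).ext fun m => ?_
  simp only [coe_basisMonomials, LinearMap.smul_apply, fischer_monomial, coeff_smul, smul_eq_mul]
  ring

/-- Each variable moves across the pairing as a derivative, which fills one slot of `T`; the factors
`n, n - 1, …, 1` accumulate to `n!`. -/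
theorem fischer_toPoly_prod_X {n : ℕ} {T : Tensor n} (hT : T ∈ SymTensor n)
    (ι : Fin n → Fin 3) :
    fischer (toPoly n T) (∏ j, X (ι j)) = n.factorial * T (fun j => stdVec (ι j)) := by
  induction n with
  | zero =>
    have h := fischer_monomial (toPoly 0 T) 0
    rw [Fin.prod_univ_zero, ← C_1, ← monomial_zero', h]
    simp [multiFactorial, toPoly_apply, smul_eq_C_mul]
    congr 1
    funext j
    exact j.elim0
  | succ n ih =>
    rw [Fin.prod_univ_succ, fischer_X_mul, pderiv_toPoly hT, fischer_smul, LinearMap.smul_apply,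
      ih (SymTensor.curryLeft_mem hT _), MultilinearMap.curryLeft_apply, Nat.factorial_succ,
      smul_eq_mul]
    push_cast
    have h : (Fin.cons (stdVec (ι 0)) fun j : Fin n => stdVec (ι j.succ) : Fin (n + 1) → E3) =
        fun j => stdVec (ι j) := by
      funext j
      refine Fin.cases rfl (fun j => rfl) j
    rw [h]
    ring

theorem fischer_toPoly_toPoly {n : ℕ} {S : Tensor n} (hS : S ∈ SymTensor n) (T : Tensor n) :
    fischer (toPoly n S) (toPoly n T) = n.factorial * tensorInner n S T := by
  rw [toPoly_apply T, map_sum, tensorInner_apply, Finset.mul_sum]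
  refine Finset.sum_congr rfl fun ι _ => ?_
  rw [map_smul, fischer_toPoly_prod_X hS, smul_eq_mul]
  ring

theorem SymTensor.eq_zero_of_toPoly_eq_zero {n : ℕ} {T : Tensor n} (hT : T ∈ SymTensor n)
    (h : toPoly n T = 0) : T = 0 := by
  apply eq_zero_of_tensorInner_self
  have h1 := fischer_toPoly_toPoly hT T
  rw [h, map_zero] at h1
  exact (mul_eq_zero.1 h1.symm).resolve_left (by positivity)

theorem SymTensor.toPoly_injOn {n : ℕ} {S T : Tensor n} (hS : S ∈ SymTensor n)
    (hT : T ∈ SymTensor n) (h : toPoly n S = toPoly n T) : S = T := by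
  rw [← sub_eq_zero]
  exact SymTensor.eq_zero_of_toPoly_eq_zero (Submodule.sub_mem _ hS hT) (by rw [map_sub, h, sub_self])

/-- The linear form with the given vector of coefficients. -/
def linearForm : E3 →ₗ[ℝ] Poly3 := (EuclideanSpace.basisFun (Fin 3) ℝ).toBasis.constr ℝ X

theorem linearForm_stdVec (i : Fin 3) : linearForm (stdVec i) = X i := by
  have h := (EuclideanSpace.basisFun (Fin 3) ℝ).toBasis.constr_basis ℝ (X : Fin 3 → Poly3) i
  rwa [OrthonormalBasis.coe_toBasis] at h

/-- The symmetric tensor `(x₁, …, xₙ) ↦ ⟨p, x₁ ⋯ xₙ⟩`. -/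
def apolarTensor (n : ℕ) (p : Poly3) : Tensor n :=
  (fischer p).compMultilinearMap
    ((MultilinearMap.mkPiAlgebra ℝ (Fin n) Poly3).compLinearMap fun _ => linearForm)

theorem apolarTensor_apply (n : ℕ) (p : Poly3) (x : Fin n → E3) :
    apolarTensor n p x = fischer p (∏ j, linearForm (x j)) := by
  simp [apolarTensor]

theorem apolarTensor_mem (n : ℕ) (p : Poly3) : apolarTensor n p ∈ SymTensor n := by
  intro σ
  ext x
  rw [permAct_apply, apolarTensor_apply, apolarTensor_apply,
    Equiv.prod_comp σ⁻¹ fun j => linearForm (x j)]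

theorem exists_prod_X_eq_monomial (m : Fin 3 →₀ ℕ) {n : ℕ} (hm : m.degree = n) :
    ∃ ι : Fin n → Fin 3, (∏ j, X (ι j) : Poly3) = monomial m 1 := by
  induction n generalizing m with
  | zero =>
    rw [Finsupp.degree_eq_zero_iff] at hm
    exact ⟨Fin.elim0, by rw [hm]; simp⟩
  | succ n ih =>
    obtain ⟨i, hi⟩ : ∃ i, m i ≠ 0 := by
      by_contra! h
      rw [show m = 0 from Finsupp.ext h, map_zero] at hm
      omega
    have hle : Finsupp.single i 1 ≤ m := by
      rw [Finsupp.single_le_iff]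
      omega
    obtain ⟨m, rfl⟩ := exists_add_of_le hle
    rw [map_add, Finsupp.degree_single] at hm
    obtain ⟨ι, hι⟩ := ih m (by omega)
    refine ⟨Fin.cons i ι, ?_⟩
    rw [Fin.prod_univ_succ]
    simp only [Fin.cons_zero, Fin.cons_succ]
    rw [hι, X, monomial_mul, one_mul]

theorem eq_of_fischer_prod_X {n : ℕ} {p r : Poly3} (hp : p.IsHomogeneous n)
    (hr : r.IsHomogeneous n)
    (h : ∀ ι : Fin n → Fin 3, fischer p (∏ j, X (ι j)) = fischer r (∏ j, X (ι j))) : p = r := by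
  ext m
  by_cases hm : m.degree = n
  · obtain ⟨ι, hι⟩ := exists_prod_X_eq_monomial m hm
    have h1 := h ι
    rw [hι, fischer_monomial, fischer_monomial] at h1
    exact mul_left_cancel₀ (multiFactorial_pos m).ne' h1
  · rw [hp.coeff_eq_zero hm, hr.coeff_eq_zero hm]

/-- `fischer_toPoly_prod_X` dictates the preimage: `1 / n!` times the apolar tensor of `p`. -/
theorem exists_symTensor_toPoly_eq {n : ℕ} {p : Poly3} (hp : p.IsHomogeneous n) :
    ∃ T ∈ SymTensor n, toPoly n T = p := by
  have hmem : (n.factorial : ℝ)⁻¹ • apolarTensor n p ∈ SymTensor n :=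
    Submodule.smul_mem _ _ (apolarTensor_mem n p)
  refine ⟨_, hmem, eq_of_fischer_prod_X (isHomogeneous_toPoly _) hp fun ι => ?_⟩
  rw [fischer_toPoly_prod_X hmem, smul_apply, apolarTensor_apply, smul_eq_mul,
    ← mul_assoc, mul_inv_cancel₀ (by positivity), one_mul]
  simp only [linearForm_stdVec]

/-! ## Harmonic tensors and harmonic polynomials -/

theorem mem_harmTensor_iff {n : ℕ} {T : Tensor n} (hT : T ∈ SymTensor n) :
    T ∈ HarmTensor n ↔ toPoly n T ∈ HarmPoly n := by
  have hhom : toPoly n T ∈ homogeneousSubmodule (Fin 3) ℝ n := isHomogeneous_toPoly T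
  rw [HarmTensor, HarmPoly, Submodule.mem_inf, Submodule.mem_inf, and_iff_right hT,
    and_iff_right hhom, LinearMap.mem_ker]
  match n, T, hT with
  | 0, T, hT =>
    refine iff_of_true trivial ?_
    simp [toPoly_apply, laplacian_apply, smul_eq_C_mul]
  | 1, T, hT =>
    refine iff_of_true trivial ?_
    rw [laplacian_apply]
    refine Finset.sum_eq_zero fun i _ => ?_
    rw [pderiv_toPoly hT]
    simp [toPoly_apply, smul_eq_C_mul]
  | n + 2, T, hT =>
    rw [toPoly_contract hT, smul_eq_zero_iff_right (by positivity)]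
    change contract T = 0 ↔ _
    refine ⟨fun h => by rw [h, map_zero], SymTensor.eq_zero_of_toPoly_eq_zero ?_⟩
    exact Submodule.sum_mem _ fun i _ =>
      SymTensor.curryLeft_mem (SymTensor.curryLeft_mem hT _) _

theorem exists_harmTensor_toPoly_eq {n : ℕ} {p : Poly3} (hp : p ∈ HarmPoly n) :
    ∃ T ∈ HarmTensor n, toPoly n T = p := by
  obtain ⟨T, hT, rfl⟩ := exists_symTensor_toPoly_eq ((mem_homogeneousSubmodule _ _).1 hp.1)
  exact ⟨T, (mem_harmTensor_iff hT).2 hp, rfl⟩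

theorem tensorHarmProj_mem {n : ℕ} (T : Tensor n) : tensorHarmProj n T ∈ HarmTensor n :=
  Submodule.projection_apply_mem _ T

theorem tensorInner_sub_tensorHarmProj {n : ℕ} {S : Tensor n} (hS : S ∈ HarmTensor n)
    (T : Tensor n) : tensorInner n S (T - tensorHarmProj n T) = 0 := by
  have h : tensorHarmProj n (T - tensorHarmProj n T) = 0 := by
    rw [map_sub, sub_eq_zero]
    exact (Submodule.projection_apply_of_mem_left _ (tensorHarmProj_mem T)).symm
  exact (LinearMap.BilinForm.mem_orthogonal_iff.1
    ((Submodule.projection_apply_eq_zero_iff _).1 h)) S hS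

/-- Multiples of `q` are apolar to harmonic polynomials, so `⟨g, g⟩ = ⟨g, p⟩`. -/
theorem eq_zero_of_fischer_harmPoly_eq_zero {g p : Poly3} (hg : laplacian g = 0)
    (hgp : normSq ∣ p - g) (h : fischer g p = 0) : g = 0 := by
  obtain ⟨r, hr⟩ := hgp
  have h0 : fischer 0 = 0 := by simpa using fischer_sub 0 0
  apply eq_zero_of_fischer_self
  have h1 : fischer g (p - g) = 0 := by
    rw [hr, fischer_normSq_mul, hg, h0, LinearMap.zero_apply]
  rwa [map_sub, h, zero_sub, neg_eq_zero] at h1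

/-- It suffices that the polynomial `p` of `T - (T)₀` has zero harmonic part. That part comes from a
harmonic tensor `S`, and `S` is orthogonal to `T - (T)₀`, so `p` is apolar to its own harmonic part.
-/
theorem toPoly_tensorHarmProj {n : ℕ} (T : Tensor n) :
    toPoly n (tensorHarmProj n T) = harmProj (toPoly n T) := by
  have hmem := tensorHarmProj_mem T
  have hlap : laplacian (toPoly n (tensorHarmProj n T)) = 0 :=
    LinearMap.mem_ker.1 ((mem_harmTensor_iff hmem.1).1 hmem).2
  rw [← harmProj_of_laplacian_eq_zero hlap, eq_comm, ← sub_eq_zero, ← map_sub, ← map_sub]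
  set p := toPoly n (T - tensorHarmProj n T) with hp
  obtain ⟨S, hS, hSp⟩ := exists_harmTensor_toPoly_eq
    (harmProj_mem_harmPoly (isHomogeneous_toPoly (T - tensorHarmProj n T)))
  refine eq_zero_of_fischer_harmPoly_eq_zero (p := p) (laplacian_harmProj p)
    (normSq_dvd_sub_harmProj p) ?_
  rw [← hp] at hSp
  rw [← hSp, hp, fischer_toPoly_toPoly hS.1, tensorInner_sub_tensorHarmProj hS, mul_zero]

theorem toPoly_tensorHarmMul {m n : ℕ} (S : Tensor m) (T : Tensor n) :
    toPoly (m + n) (tensorHarmMul S T) = harmMul (toPoly m S) (toPoly n T) := by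
  rw [tensorHarmMul, toPoly_tensorHarmProj, toPoly_symMul, harmMul]

theorem toPoly_tensorHarmProd {n : ℕ} (k : ℕ) (F : Fin k → Tensor n) :
    toPoly (n * k) (tensorHarmProd k F) = harmProd k fun i => toPoly n (F i) := by
  induction k with
  | zero => exact toPoly_one
  | succ k ih =>
    exact (toPoly_tensorHarmMul _ _).trans (congrArg (harmMul · _) (ih _))

theorem tensorHarmProd_mem {n k : ℕ} (hk : 1 ≤ k) (F : Fin k → Tensor n) :
    tensorHarmProd k F ∈ HarmTensor (n * k) := by
  obtain ⟨k, rfl⟩ : ∃ j, k = j + 1 := ⟨k - 1, by omega⟩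
  exact tensorHarmProj_mem (n := n * k + n) _

theorem exists_eq_tensorHarmProd {n k : ℕ} (hk : 1 ≤ k) {H : Tensor (n * k)}
    (hH : H ∈ HarmTensor (n * k)) :
    ∃ F : Fin k → Tensor n, (∀ i, F i ∈ HarmTensor n) ∧ H = tensorHarmProd k F := by
  obtain ⟨f, hf, hHf⟩ := exists_eq_harmProd hk ((mem_harmTensor_iff hH.1).1 hH)
  choose F hF hFf using fun i => exists_harmTensor_toPoly_eq (hf i)
  refine ⟨F, hF, SymTensor.toPoly_injOn hH.1 (tensorHarmProd_mem hk F).1 ?_⟩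
  rw [hHf, toPoly_tensorHarmProd]
  simp only [hFf]

theorem exists_eq_tensorHarmMul {H : Tensor 4} (hH : H ∈ HarmTensor 4) :
    ∃ h₁ ∈ HarmTensor 2, ∃ h₂ ∈ HarmTensor 2, H = tensorHarmMul h₁ h₂ := by
  obtain ⟨f, hf, hHf⟩ := exists_eq_harmProd (n := 2) (k := 2) (by norm_num)
    ((mem_harmTensor_iff hH.1).1 hH)
  choose F hF hFf using fun i => exists_harmTensor_toPoly_eq (hf i)
  refine ⟨F 0, hF 0, F 1, hF 1,
    SymTensor.toPoly_injOn hH.1 (tensorHarmProj_mem (n := 2 + 2) _).1 ?_⟩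
  -- Writing the factors as projections collapses `(1 ∗ f₀) ∗ f₁` to `(f₀ f₁)₀`, which removes the
  -- leading unit.
  have h : f = fun i => harmProj (f i) := funext fun i =>
    (harmProj_of_laplacian_eq_zero (LinearMap.mem_ker.1 (hf i).2)).symm
  rw [hHf, h, harmProd_harmProj, Fin.prod_univ_two, ← hFf, ← hFf]
  exact (toPoly_tensorHarmMul _ _).symm

end HarmonicFactorization

end

theorem mainTheorem2 :
    (∀ n k : ℕ, 1 ≤ k → ∀ h ∈ HarmPoly (n * k),
      ∃ f : Fin k → Poly3, (∀ i, f i ∈ HarmPoly n) ∧ h = harmProd k f) ∧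
    (∀ n k : ℕ, 1 ≤ k → ∀ H ∈ HarmTensor (n * k),
      ∃ F : Fin k → Tensor n, (∀ i, F i ∈ HarmTensor n) ∧ H = tensorHarmProd k F) ∧
    (∀ H ∈ HarmTensor 4,
      ∃ h₁ ∈ HarmTensor 2, ∃ h₂ ∈ HarmTensor 2, H = tensorHarmMul h₁ h₂) :=
  ⟨fun _ _ hk _ hh => exists_eq_harmProd hk hh, fun _ _ hk _ hH => exists_eq_tensorHarmProd hk hH,
    fun _ hH => exists_eq_tensorHarmMul hH⟩
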